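/- Let $N$ be a positive integer and let $\mathbb T^N$ be the $N$-dimensional torus with normalized Haar measure $dx$ and dual group $\mathbb Z^N$. Let $P\subset\mathbb Z^N$ be an order, that is, $P\cap(-P)=\{0\}$, $P\cup(-P)=\mathbb Z^N$ and $P+P=P$. Let $f\in H^1_P(\mathbb T^N)$, that is, $f\in L^1(\mathbb T^N)$ and $\widehat f(n)=0$ for every $n\in\mathbb Z^N\setminus P$. Then the positive part of $\log|f|$ is integrable, so that $\int_{\mathbb T^N}\log|f|\,dx$ is well defined in $[-\infty,\infty)$ (with $\log 0=-\infty$), and $$\left|\int_{\mathbb T^N}f\,dx\right|\le\exp\left(\int_{\mathbb T^N}\log|f|\,dx\right),$$ where $\exp(-\infty)=0$. -/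

import Mathlib

open MeasureTheory
open scoped Pointwise ENNReal

noncomputable section

namespace HardyTorus

/-- An order on an abelian group `Γ` in the sense of Helson and Lowdenslager, given by its set `P`
of nonnegative elements. `-P` and `P + P` are the pointwise negation and the pointwise sum. -/
structure IsOrder {Γ : Type*} [AddCommGroup Γ] (P : Set Γ) : Prop where
  inter_neg : P ∩ (-P) = {0}
  union_neg : P ∪ (-P) = Set.univ
  add_self : P + P = P

/-- Normalized Haar measure on `𝕋ᴺ`: the product of the Haar probability measures of the factors.
This is the measure that Mathlib uses to define `UnitAddTorus.mFourierCoeff`. -/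
abbrev haar (N : ℕ) : Measure (UnitAddTorus (Fin N)) :=
  Measure.pi fun _ => AddCircle.haarAddCircle

/-- The Hardy space `Hᵖ_P(𝕋ᴺ)`: the functions in `Lᵖ(𝕋ᴺ)` whose Fourier transform vanishes
off `P`. The dual group of `𝕋ᴺ` is `ℤᴺ`, that is `Fin N → ℤ`. -/
def hardySpace {N : ℕ} (p : ℝ≥0∞) (P : Set (Fin N → ℤ)) : Set (UnitAddTorus (Fin N) → ℂ) :=
  {f | MemLp f p (haar N) ∧ ∀ n : Fin N → ℤ, n ∉ P → UnitAddTorus.mFourierCoeff f n = 0}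

/-- The integral of a function with values in `[-∞, ∞]`, as the integral of its positive part minus
the integral of its negative part. It is the usual integral as soon as one of them is finite. -/
def erealIntegral {α : Type*} [MeasurableSpace α] (μ : Measure α) (g : α → EReal) : EReal :=
  ((∫⁻ x, (g x).toENNReal ∂μ : ℝ≥0∞) : EReal) - ((∫⁻ x, (-g x).toENNReal ∂μ : ℝ≥0∞) : EReal)

/-- `log |f|` with values in `[-∞, ∞)`; it is `-∞` where `f` vanishes. -/
def logAbs {α : Type*} (f : α → ℂ) (x : α) : EReal := ENNReal.log ‖f x‖ₑ

end HardyTorus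

end

namespace HardyTorus

open UnitAddTorus Filter Topology

variable {N : ℕ} {P : Set (Fin N → ℤ)}

namespace IsOrder

variable {Γ : Type*} [AddCommGroup Γ] {Q : Set Γ}

/-! A nonconstant character with frequency in `P` contributes nothing to the mean of its product
with `f`, since `P` meets `-P` only at 0. So the mean is multiplicative for such products, and
expanding the exponential gives `∫ f e^(-g) = (∫ f) e^(-∫ g)` for `g` an analytic polynomial
(`integral_mul_exp`). Taking absolute values, `|∫ f| ≤ (∫ |f| e^(-u)) e^(∫ u)` with `u = Re g`.

As `P ∪ -P` is everything, such `u` are uniformly dense in the real continuous functions, and the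
bound passes to every integrable `u` bounded below (`norm_integral_le_of_integrable`). For `u = max
(log |f|) (-k)` the first factor is at most 1; letting `k → ∞` gives the claim by monotone
convergence. -/

theorem zero_mem (hQ : IsOrder Q) : (0 : Γ) ∈ Q := by
  have : (0 : Γ) ∈ Q ∩ (-Q) := by rw [hQ.inter_neg]; rfl
  exact this.1

theorem add_mem (hQ : IsOrder Q) {a b : Γ} (ha : a ∈ Q) (hb : b ∈ Q) : a + b ∈ Q := by
  rw [← hQ.add_self]
  exact Set.add_mem_add ha hb

theorem eq_zero (hQ : IsOrder Q) {a : Γ} (ha : a ∈ Q) (ha' : -a ∈ Q) : a = 0 := by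
  have : a ∈ Q ∩ (-Q) := ⟨ha, ha'⟩
  rwa [hQ.inter_neg] at this

theorem mem_or_neg_mem (hQ : IsOrder Q) (a : Γ) : a ∈ Q ∨ -a ∈ Q := by
  have : a ∈ Q ∪ (-Q) := by rw [hQ.union_neg]; trivial
  exact this

end IsOrder

/-- The trigonometric polynomials with spectrum in `P`. -/
noncomputable def analyticPolynomials (P : Set (Fin N → ℤ)) : Submodule ℂ C(UnitAddTorus (Fin N), ℂ) :=
  Submodule.span ℂ (mFourier '' P)

/-! ### Multiplicativity of the mean -/

theorem mFourierCoeff_eq (f : UnitAddTorus (Fin N) → ℂ) (n : Fin N → ℤ) :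
    mFourierCoeff f n = ∫ x, mFourier (-n) x * f x ∂(haar N) := rfl

theorem mFourierCoeff_zero_eq (f : UnitAddTorus (Fin N) → ℂ) :
    mFourierCoeff f 0 = ∫ x, f x ∂(haar N) := by
  simp [mFourierCoeff_eq, mFourier_zero]

theorem integrable_mul_continuousMap {f : UnitAddTorus (Fin N) → ℂ} (hf : Integrable f (haar N))
    (g : C(UnitAddTorus (Fin N), ℂ)) : Integrable (fun x => f x * g x) (haar N) :=
  hf.mul_bdd (c := ‖g‖) g.continuous.aestronglyMeasurable (.of_forall g.norm_coe_le_norm)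

theorem integrable_continuous {E : Type*} [NormedAddCommGroup E] {g : UnitAddTorus (Fin N) → E}
    (hg : Continuous g) : Integrable g (haar N) :=
  hg.integrable_of_hasCompactSupport (HasCompactSupport.of_compactSpace g)

theorem mFourierCoeff_mul_mFourier (f : UnitAddTorus (Fin N) → ℂ) (m k : Fin N → ℤ) :
    mFourierCoeff (fun x => f x * mFourier m x) k = mFourierCoeff f (k - m) := by
  simp only [mFourierCoeff_eq]
  congr 1
  ext x
  rw [neg_sub, sub_eq_add_neg, mFourier_add]
  ring

theorem integral_mFourier {n : Fin N → ℤ} (hn : n ≠ 0) :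
    ∫ x, mFourier n x ∂(haar N) = 0 := by
  have h := (orthonormal_iff_ite.mp (orthonormal_mFourier (d := Fin N))) 0 n
  rw [if_neg hn.symm, ContinuousMap.inner_toLp] at h
  simp only [mFourier_zero, ContinuousMap.one_apply, map_one, mul_one] at h
  exact h

/-- For a character of frequency `m ∈ P`, `m ≠ 0`, the mean of the product is the coefficient of `f`
at `-m`, which is not in `P`. Membership of the product is what lets powers of `g` be treated by
iteration. -/
theorem mul_mem_hardySpace (hP : IsOrder P) {g : C(UnitAddTorus (Fin N), ℂ)}
    (hg : g ∈ analyticPolynomials P) : ∀ {f : UnitAddTorus (Fin N) → ℂ},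
    f ∈ hardySpace 1 P → (fun x => f x * g x) ∈ hardySpace 1 P ∧
      ∫ x, f x * g x ∂(haar N) = (∫ x, f x ∂(haar N)) * ∫ x, g x ∂(haar N) := by
  induction hg using Submodule.span_induction with
  | mem g hg =>
    obtain ⟨m, hm, rfl⟩ := hg
    intro f hf
    have hi := memLp_one_iff_integrable.mp hf.1
    refine ⟨⟨memLp_one_iff_integrable.mpr (integrable_mul_continuousMap hi _), fun k hk => ?_⟩, ?_⟩
    · rw [mFourierCoeff_mul_mFourier]
      refine hf.2 _ fun h => hk ?_
      simpa using hP.add_mem h hm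
    · rcases eq_or_ne m 0 with rfl | h0
      · simp [mFourier_zero]
      · rw [integral_mFourier h0, mul_zero, ← mFourierCoeff_zero_eq, mFourierCoeff_mul_mFourier,
          zero_sub]
        exact hf.2 _ fun h => h0 (hP.eq_zero hm h)
  | zero =>
    intro f hf
    refine ⟨⟨by simp, fun k _ => by simp [mFourierCoeff_eq]⟩, by simp⟩
  | add a b _ _ iha ihb =>
    intro f hf
    obtain ⟨⟨ha1, ha2⟩, ha3⟩ := iha hf
    obtain ⟨⟨hb1, hb2⟩, hb3⟩ := ihb hf
    have e : (fun x => f x * (a + b) x) = (fun x => f x * a x) + fun x => f x * b x := by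
      ext x; simp [mul_add]
    have ia := memLp_one_iff_integrable.mp ha1
    have ib := memLp_one_iff_integrable.mp hb1
    refine ⟨⟨e ▸ ha1.add hb1, fun k hk => ?_⟩, ?_⟩
    · have h1 := ha2 k hk
      have h2 := hb2 k hk
      simp only [mFourierCoeff_eq] at h1 h2 ⊢
      simp only [ContinuousMap.add_apply, mul_add]
      rw [integral_add, h1, h2, add_zero]
      · simpa only [mul_comm] using integrable_mul_continuousMap ia (mFourier (-k))
      · simpa only [mul_comm] using integrable_mul_continuousMap ib (mFourier (-k))
    · simp only [ContinuousMap.add_apply, mul_add]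
      rw [integral_add ia ib, integral_add (integrable_continuous a.continuous)
        (integrable_continuous b.continuous), ha3, hb3, mul_add]
  | smul c a _ iha =>
    intro f hf
    obtain ⟨⟨ha1, ha2⟩, ha3⟩ := iha hf
    have e : (fun x => f x * (c • a) x) = c • (fun x => f x * a x) := by
      ext x; simp [mul_left_comm]
    refine ⟨⟨e ▸ ha1.const_smul c, fun k hk => ?_⟩, ?_⟩
    · have h1 := ha2 k hk
      simp only [mFourierCoeff_eq] at h1 ⊢
      simp only [ContinuousMap.smul_apply, smul_eq_mul, mul_left_comm _ c]
      rw [integral_const_mul, h1, mul_zero]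
    · simp only [ContinuousMap.smul_apply, smul_eq_mul, mul_left_comm _ c]
      rw [integral_const_mul, integral_const_mul, ha3]
      ring

theorem mul_pow_mem_hardySpace (hP : IsOrder P) {f : UnitAddTorus (Fin N) → ℂ}
    (hf : f ∈ hardySpace 1 P) {g : C(UnitAddTorus (Fin N), ℂ)} (hg : g ∈ analyticPolynomials P)
    (k : ℕ) : (fun x => f x * g x ^ k) ∈ hardySpace 1 P ∧
      ∫ x, f x * g x ^ k ∂(haar N) = (∫ x, f x ∂(haar N)) * (∫ x, g x ∂(haar N)) ^ k := by
  induction k with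
  | zero => simpa using hf
  | succ k ih =>
    obtain ⟨h1, h2⟩ := mul_mem_hardySpace hP hg ih.1
    simp only [pow_succ, ← mul_assoc]
    exact ⟨h1, by rw [h2, ih.2]⟩

/-- The exponential series is integrated term by term, dominated by `|f| ‖g‖^k / k!` with the sup
norm of `g`. -/
theorem integral_mul_exp (hP : IsOrder P) {f : UnitAddTorus (Fin N) → ℂ}
    (hf : f ∈ hardySpace 1 P) {g : C(UnitAddTorus (Fin N), ℂ)} (hg : g ∈ analyticPolynomials P) :
    ∫ x, f x * Complex.exp (g x) ∂(haar N) =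
      (∫ x, f x ∂(haar N)) * Complex.exp (∫ x, g x ∂(haar N)) := by
  have hi := memLp_one_iff_integrable.mp hf.1
  have hexp (z : ℂ) : HasSum (fun k : ℕ => z ^ k / (k.factorial : ℂ)) (Complex.exp z) := by
    rw [Complex.exp_eq_exp_ℂ]
    exact NormedSpace.expSeries_div_hasSum_exp z
  have hsum : Summable fun k : ℕ => ‖g‖ ^ k / (k.factorial : ℝ) :=
    Real.summable_pow_div_factorial _
  have key := hasSum_integral_of_dominated_convergence (μ := haar N)
    (F := fun (k : ℕ) x => f x * (g x ^ k / (k.factorial : ℂ)))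
    (f := fun x => f x * Complex.exp (g x))
    (fun k x => ‖f x‖ * (‖g‖ ^ k / (k.factorial : ℝ)))
    (fun k => hi.aestronglyMeasurable.mul
      (((g.continuous.pow k).div_const _).aestronglyMeasurable))
    (fun k => .of_forall fun x => by
      rw [norm_mul, norm_div, norm_pow, Complex.norm_natCast]
      gcongr
      exact g.norm_coe_le_norm x)
    (.of_forall fun x => hsum.mul_left _)
    (by simpa only [tsum_mul_left] using hi.norm.mul_const _)
    (.of_forall fun x => (hexp (g x)).mul_left _)
  have hterm (k : ℕ) : ∫ x, f x * (g x ^ k / (k.factorial : ℂ)) ∂(haar N) =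
      (∫ x, f x ∂(haar N)) * ((∫ x, g x ∂(haar N)) ^ k / (k.factorial : ℂ)) := by
    rw [← mul_div_assoc, ← (mul_pow_mem_hardySpace hP hf hg k).2, ← integral_div]
    simp only [mul_div_assoc]
  simp only [hterm] at key
  exact key.unique ((hexp _).mul_left _)

/-! ### From analytic polynomials to integrable exponents -/

/-- Conjugation preserves real parts and moves frequencies from `-P` to `P`. The factor `c` is
needed in the induction because taking real parts is not complex linear. -/
theorem exists_analyticPolynomial_re_eq (hP : IsOrder P) {t : C(UnitAddTorus (Fin N), ℂ)}
    (ht : t ∈ Submodule.span ℂ (Set.range (mFourier (d := Fin N)))) :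
    ∀ c : ℂ, ∃ g ∈ analyticPolynomials P, ∀ x, (g x).re = (c * t x).re := by
  induction ht using Submodule.span_induction with
  | mem t ht =>
    obtain ⟨n, rfl⟩ := ht
    intro c
    rcases hP.mem_or_neg_mem n with h | h
    · exact ⟨c • mFourier n, Submodule.smul_mem _ _ (Submodule.subset_span ⟨n, h, rfl⟩),
        fun x => by simp⟩
    · refine ⟨(starRingEnd ℂ c) • mFourier (-n),
        Submodule.smul_mem _ _ (Submodule.subset_span ⟨_, h, rfl⟩), fun x => ?_⟩
      rw [ContinuousMap.smul_apply, mFourier_neg, smul_eq_mul, ← map_mul, Complex.conj_re]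
  | zero => exact fun c => ⟨0, Submodule.zero_mem _, by simp⟩
  | add a b _ _ iha ihb =>
    intro c
    obtain ⟨g, hg, hg'⟩ := iha c
    obtain ⟨h, hh, hh'⟩ := ihb c
    exact ⟨g + h, Submodule.add_mem _ hg hh, fun x => by
      simp only [ContinuousMap.add_apply, mul_add, Complex.add_re, hg' x, hh' x]⟩
  | smul d a _ iha =>
    intro c
    obtain ⟨g, hg, hg'⟩ := iha (c * d)
    exact ⟨g, hg, fun x => by rw [hg' x, ContinuousMap.smul_apply, smul_eq_mul, mul_assoc]⟩

theorem exists_analyticPolynomial_re_near (hP : IsOrder P) {u : UnitAddTorus (Fin N) → ℝ}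
    (hu : Continuous u) {δ : ℝ} (hδ : 0 < δ) :
    ∃ g ∈ analyticPolynomials P, ∀ x, |u x - (g x).re| ≤ δ := by
  let v : C(UnitAddTorus (Fin N), ℂ) := ⟨fun x => (u x : ℂ), by fun_prop⟩
  have hv : v ∈ (Submodule.span ℂ (Set.range (mFourier (d := Fin N)))).topologicalClosure := by
    rw [span_mFourier_closure_eq_top]; trivial
  obtain ⟨t, ht, hvt⟩ := Metric.mem_closure_iff.mp hv δ hδ
  obtain ⟨g, hg, hgt⟩ := exists_analyticPolynomial_re_eq hP ht 1
  refine ⟨g, hg, fun x => ?_⟩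
  rw [hgt x, one_mul]
  have h1 : u x - (t x).re = (v x - t x).re := by simp [v]
  rw [h1]
  refine (Complex.abs_re_le_norm _).trans ?_
  rw [← dist_eq_norm]
  exact (ContinuousMap.dist_apply_le_dist x).trans hvt.le

theorem norm_integral_le_of_analyticPolynomial (hP : IsOrder P) {f : UnitAddTorus (Fin N) → ℂ}
    (hf : f ∈ hardySpace 1 P) {g : C(UnitAddTorus (Fin N), ℂ)} (hg : g ∈ analyticPolynomials P) :
    ‖∫ x, f x ∂(haar N)‖ ≤
      (∫ x, ‖f x‖ * Real.exp (-(g x).re) ∂(haar N)) * Real.exp (∫ x, (g x).re ∂(haar N)) := by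
  have h := integral_mul_exp hP hf (Submodule.neg_mem _ hg)
  have hre : (∫ x, g x ∂(haar N)).re = ∫ x, (g x).re ∂(haar N) :=
    (integral_re (𝕜 := ℂ) (integrable_continuous g.continuous)).symm
  have h2 : ‖∫ x, f x * Complex.exp ((-g) x) ∂(haar N)‖ ≤
      ∫ x, ‖f x‖ * Real.exp (-(g x).re) ∂(haar N) := by
    refine (norm_integral_le_integral_norm _).trans_eq ?_
    simp [Complex.norm_exp]
  rw [h, norm_mul, Complex.norm_exp] at h2
  simp only [ContinuousMap.neg_apply, integral_neg, Complex.neg_re, hre, Real.exp_neg (∫ x, _ ∂_)]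
    at h2
  rwa [← div_eq_mul_inv, div_le_iff₀ (Real.exp_pos _)] at h2

theorem norm_integral_le_of_continuous (hP : IsOrder P) {f : UnitAddTorus (Fin N) → ℂ}
    (hf : f ∈ hardySpace 1 P) {u : UnitAddTorus (Fin N) → ℝ} (hu : Continuous u) :
    ‖∫ x, f x ∂(haar N)‖ ≤
      (∫ x, ‖f x‖ * Real.exp (-u x) ∂(haar N)) * Real.exp (∫ x, u x ∂(haar N)) := by
  have hi := memLp_one_iff_integrable.mp hf.1
  have hint {v : UnitAddTorus (Fin N) → ℝ} (hv : Continuous v) :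
      Integrable (fun x => ‖f x‖ * Real.exp (-v x)) (haar N) := by
    obtain ⟨C, hC⟩ := isCompact_univ.exists_bound_of_continuousOn
      (f := fun x => Real.exp (-v x)) (by fun_prop)
    exact hi.norm.mul_bdd (c := C) (by fun_prop) (.of_forall fun x => hC x trivial)
  -- A uniform error `δ` in the exponent costs `e^δ` in each of the two factors.
  have key (δ : ℝ) (hδ : 0 < δ) : ‖∫ x, f x ∂(haar N)‖ ≤ Real.exp (2 * δ) *
      ((∫ x, ‖f x‖ * Real.exp (-u x) ∂(haar N)) * Real.exp (∫ x, u x ∂(haar N))) := by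
    obtain ⟨g, hg, hgu⟩ := exists_analyticPolynomial_re_near hP hu hδ
    have hgc : Continuous fun x => (g x).re := by fun_prop
    have h1 : ∫ x, ‖f x‖ * Real.exp (-(g x).re) ∂(haar N) ≤
        Real.exp δ * ∫ x, ‖f x‖ * Real.exp (-u x) ∂(haar N) := by
      rw [← integral_const_mul]
      refine integral_mono (hint hgc) ((hint hu).const_mul _) fun x => ?_
      have : Real.exp (-(g x).re) ≤ Real.exp δ * Real.exp (-u x) := by
        rw [← Real.exp_add]
        gcongr
        linarith [(abs_le.mp (hgu x)).2]
      calc _ ≤ ‖f x‖ * (Real.exp δ * Real.exp (-u x)) := by gcongr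
        _ = _ := by ring
    have h2 : ∫ x, (g x).re ∂(haar N) ≤ δ + ∫ x, u x ∂(haar N) := by
      have : ∫ x, (g x).re ∂(haar N) ≤ ∫ x, (δ + u x) ∂(haar N) :=
        integral_mono (integrable_continuous hgc) (integrable_continuous (by fun_prop))
          fun x => by have := (abs_le.mp (hgu x)).1; dsimp only; linarith
      rwa [integral_add (integrable_const _) (integrable_continuous hu), integral_const,
        probReal_univ, one_smul] at this
    calc _ ≤ _ := norm_integral_le_of_analyticPolynomial hP hf hg
      _ ≤ (Real.exp δ * ∫ x, ‖f x‖ * Real.exp (-u x) ∂(haar N)) *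
          Real.exp (δ + ∫ x, u x ∂(haar N)) := by
        gcongr
      _ = _ := by rw [two_mul, Real.exp_add, Real.exp_add]; ring
  have hlim : Tendsto (fun δ : ℝ => Real.exp (2 * δ) *
      ((∫ x, ‖f x‖ * Real.exp (-u x) ∂(haar N)) * Real.exp (∫ x, u x ∂(haar N)))) (𝓝[>] 0)
      (𝓝 (Real.exp (2 * 0) *
      ((∫ x, ‖f x‖ * Real.exp (-u x) ∂(haar N)) * Real.exp (∫ x, u x ∂(haar N))))) :=
    (Continuous.tendsto (by fun_prop) 0).mono_left nhdsWithin_le_nhds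
  simpa using ge_of_tendsto hlim (eventually_nhdsWithin_of_forall key)

/-- Cutting off `L¹` approximants below at `c` is a contraction fixing `u`; a subsequence then
converges a.e. The common lower bound later provides the domination. -/
theorem exists_seq_continuous_tendsto {u : UnitAddTorus (Fin N) → ℝ} (hu : Integrable u (haar N))
    {c : ℝ} (hc : ∀ x, c ≤ u x) : ∃ v : ℕ → UnitAddTorus (Fin N) → ℝ,
      (∀ n, Continuous (v n)) ∧ (∀ n x, c ≤ v n x) ∧
      (∀ᵐ x ∂(haar N), Tendsto (fun n => v n x) atTop (𝓝 (u x))) ∧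
      Tendsto (fun n => ∫ x, v n x ∂(haar N)) atTop (𝓝 (∫ x, u x ∂(haar N))) := by
  have hε (n : ℕ) : ((n : ℝ≥0∞) + 1)⁻¹ ≠ 0 := by simp
  choose g hg _ using fun n : ℕ =>
    (memLp_one_iff_integrable.mpr hu).exists_boundedContinuous_eLpNorm_sub_le ENNReal.one_ne_top (hε n)
  let v : ℕ → UnitAddTorus (Fin N) → ℝ := fun n x => max (g n x) c
  have hv (n : ℕ) : Continuous (v n) := (g n).continuous.max continuous_const
  have hle (n : ℕ) : eLpNorm (v n - u) 1 (haar N) ≤ ((n : ℝ≥0∞) + 1)⁻¹ := by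
    refine le_trans (eLpNorm_mono fun x => ?_) (hg n)
    rw [Pi.sub_apply, Pi.sub_apply, norm_sub_rev (u x)]
    have := abs_max_sub_max_le_abs (g n x) (u x) c
    rwa [max_eq_left (hc x)] at this
  have hlim : Tendsto (fun n => eLpNorm (v n - u) 1 (haar N)) atTop (𝓝 0) := by
    refine tendsto_of_tendsto_of_tendsto_of_le_of_le tendsto_const_nhds ?_ (fun _ => zero_le) hle
    exact_mod_cast (tendsto_add_atTop_iff_nat 1).mpr ENNReal.tendsto_inv_nat_nhds_zero
  obtain ⟨ns, hns, hae⟩ := (tendstoInMeasure_of_tendsto_eLpNorm one_ne_zero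
    (fun n => (hv n).aestronglyMeasurable) hu.aestronglyMeasurable hlim).exists_seq_tendsto_ae
  exact ⟨fun n => v (ns n), fun n => hv _, fun n x => le_max_right _ _, hae,
    (tendsto_integral_of_L1' u hu.aestronglyMeasurable (.of_forall fun n => integrable_continuous (hv n)) hlim).comp
      hns.tendsto_atTop⟩

theorem norm_integral_le_of_integrable (hP : IsOrder P) {f : UnitAddTorus (Fin N) → ℂ}
    (hf : f ∈ hardySpace 1 P) {u : UnitAddTorus (Fin N) → ℝ} (hu : Integrable u (haar N))
    {c : ℝ} (hc : ∀ x, c ≤ u x) :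
    ‖∫ x, f x ∂(haar N)‖ ≤
      (∫ x, ‖f x‖ * Real.exp (-u x) ∂(haar N)) * Real.exp (∫ x, u x ∂(haar N)) := by
  have hi := memLp_one_iff_integrable.mp hf.1
  obtain ⟨v, hv, hcv, hae, hlim⟩ := exists_seq_continuous_tendsto hu hc
  have h1 : Tendsto (fun n => ∫ x, ‖f x‖ * Real.exp (-v n x) ∂(haar N)) atTop
      (𝓝 (∫ x, ‖f x‖ * Real.exp (-u x) ∂(haar N))) := by
    refine tendsto_integral_of_dominated_convergence (fun x => ‖f x‖ * Real.exp (-c))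
      (fun n => hi.norm.aestronglyMeasurable.mul
        (Real.continuous_exp.comp (hv n).neg).aestronglyMeasurable)
      (hi.norm.mul_const _) (fun n => .of_forall fun x => ?_) ?_
    · rw [norm_mul, norm_norm, Real.norm_of_nonneg (Real.exp_pos _).le]
      gcongr
      exact hcv n x
    · filter_upwards [hae] with x hx
      exact ((Real.continuous_exp.tendsto _).comp hx.neg).const_mul _
  exact ge_of_tendsto (h1.mul ((Real.continuous_exp.tendsto _).comp hlim))
    (.of_forall fun n => norm_integral_le_of_continuous hP hf (hv n))

/-- `log |f|`, truncated from below at `-k`. -/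
noncomputable def truncatedLog {α : Type*} (f : α → ℂ) (k : ℕ) (x : α) : ℝ :=
  Real.log (max ‖f x‖ (Real.exp (-k)))

/-! ### Truncations of `log |f|` -/

section Pointwise

variable {α : Type*} (f : α → ℂ) (k : ℕ) (x : α)

/-- With the maximum inside the logarithm, the default `Real.log 0 = 0` plays no role at zeros of
`f`. -/
theorem truncatedLog_of_eq_zero {f : α → ℂ} {x : α} (h : f x = 0) :
    truncatedLog f k x = -k := by
  simp [truncatedLog, h, max_eq_right (Real.exp_pos _).le]

theorem truncatedLog_of_ne_zero {f : α → ℂ} {x : α} (h : f x ≠ 0) :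
    truncatedLog f k x = max (Real.log ‖f x‖) (-k) := by
  rw [truncatedLog]
  rcases le_total ‖f x‖ (Real.exp (-k)) with h' | h'
  · rw [max_eq_right h', Real.log_exp, max_eq_right]
    exact (Real.log_le_iff_le_exp (norm_pos_iff.mpr h)).mpr h'
  · rw [max_eq_left h', max_eq_left]
    exact (Real.le_log_iff_exp_le (norm_pos_iff.mpr h)).mpr h'

theorem logAbs_of_eq_zero {f : α → ℂ} {x : α} (h : f x = 0) : logAbs f x = ⊥ := by
  simp [logAbs, h]

theorem logAbs_of_ne_zero {f : α → ℂ} {x : α} (h : f x ≠ 0) :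
    logAbs f x = (Real.log ‖f x‖ : ℝ) := by
  rw [logAbs, ← ofReal_norm, ENNReal.log_ofReal_of_pos (norm_pos_iff.mpr h)]

theorem neg_le_truncatedLog : -(k : ℝ) ≤ truncatedLog f k x := by
  rcases eq_or_ne (f x) 0 with h | h
  · rw [truncatedLog_of_eq_zero k h]
  · rw [truncatedLog_of_ne_zero k h]
    exact le_max_right _ _

/-- Since `-k ≤ 0`, truncation leaves the positive part untouched and only caps the negative part at
`k`. -/
theorem ofReal_truncatedLog :
    ENNReal.ofReal (truncatedLog f k x) = (logAbs f x).toENNReal := by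
  rcases eq_or_ne (f x) 0 with h | h
  · simp [truncatedLog_of_eq_zero k h, logAbs_of_eq_zero h]
  · rw [truncatedLog_of_ne_zero k h, logAbs_of_ne_zero h, EReal.real_coe_toENNReal,
      ENNReal.ofReal_max, ENNReal.ofReal_of_nonpos (neg_nonpos.mpr k.cast_nonneg),
      max_eq_left zero_le]

theorem ofReal_neg_truncatedLog :
    ENNReal.ofReal (-truncatedLog f k x) = min (-logAbs f x).toENNReal k := by
  rcases eq_or_ne (f x) 0 with h | h
  · simp [truncatedLog_of_eq_zero k h, logAbs_of_eq_zero h]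
  · rw [truncatedLog_of_ne_zero k h, logAbs_of_ne_zero h, ← EReal.coe_neg,
      EReal.real_coe_toENNReal, ← min_neg_neg, neg_neg, ENNReal.ofReal_min, ENNReal.ofReal_natCast]

theorem abs_truncatedLog_le : |truncatedLog f k x| ≤ ‖f x‖ + k := by
  have h0 := norm_nonneg (f x)
  have hk : (0 : ℝ) ≤ k := k.cast_nonneg
  rw [abs_le]
  refine ⟨by linarith [neg_le_truncatedLog f k x], ?_⟩
  rcases eq_or_ne (f x) 0 with h | h
  · rw [truncatedLog_of_eq_zero k h]
    linarith
  · rw [truncatedLog_of_ne_zero k h]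
    exact max_le (by linarith [Real.log_le_sub_one_of_pos (norm_pos_iff.mpr h)]) (by linarith)

theorem norm_mul_exp_neg_truncatedLog_le : ‖f x‖ * Real.exp (-truncatedLog f k x) ≤ 1 := by
  have h : 0 < max ‖f x‖ (Real.exp (-k)) := lt_max_of_lt_right (Real.exp_pos _)
  rw [truncatedLog, Real.exp_neg, Real.exp_log h, ← div_eq_mul_inv, div_le_one h]
  exact le_max_left _ _

end Pointwise

section Integral

variable {α : Type*} [MeasurableSpace α] {μ : Measure α} {f : α → ℂ}

theorem integrable_truncatedLog [IsFiniteMeasure μ] (hf : Integrable f μ) (k : ℕ) :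
    Integrable (truncatedLog f k) μ := by
  refine (hf.norm.add (integrable_const (k : ℝ))).mono' ?_
    (.of_forall fun x => abs_truncatedLog_le f k x)
  exact (Real.measurable_log.comp_aemeasurable
    (hf.norm.aemeasurable.max aemeasurable_const)).aestronglyMeasurable

theorem lintegral_toENNReal_logAbs_lt_top (hf : Integrable f μ) :
    ∫⁻ x, (logAbs f x).toENNReal ∂μ < ∞ := by
  refine lt_of_le_of_lt (lintegral_mono fun x => ?_) hf.2
  -- At `k = 0` the truncation is the positive part itself, bounded by `|f|`.
  rw [← ofReal_truncatedLog f 0 x, ← ofReal_norm]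
  exact ENNReal.ofReal_le_ofReal
    ((le_abs_self _).trans (by simpa using abs_truncatedLog_le f 0 x))

theorem coe_integral_truncatedLog [IsFiniteMeasure μ] (hf : Integrable f μ) (k : ℕ) :
    ((∫ x, truncatedLog f k x ∂μ : ℝ) : EReal) =
      ((∫⁻ x, (logAbs f x).toENNReal ∂μ : ℝ≥0∞) : EReal) -
        ((∫⁻ x, min (-logAbs f x).toENNReal k ∂μ : ℝ≥0∞) : EReal) := by
  have hB : ∫⁻ x, min (-logAbs f x).toENNReal k ∂μ ≠ ∞ := by
    refine ((lintegral_mono fun x => min_le_right _ _).trans_lt ?_).ne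
    rw [lintegral_const]
    exact ENNReal.mul_lt_top (ENNReal.natCast_lt_top k) (measure_lt_top μ _)
  rw [integral_eq_lintegral_pos_part_sub_lintegral_neg_part (integrable_truncatedLog hf k),
    EReal.coe_sub]
  simp only [ofReal_truncatedLog, ofReal_neg_truncatedLog]
  rw [EReal.coe_ennreal_toReal (lintegral_toENNReal_logAbs_lt_top hf).ne,
    EReal.coe_ennreal_toReal hB]

theorem tendsto_integral_truncatedLog [IsFiniteMeasure μ] (hf : Integrable f μ) :
    Tendsto (fun k => ((∫ x, truncatedLog f k x ∂μ : ℝ) : EReal)) atTop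
      (𝓝 (erealIntegral μ (logAbs f))) := by
  have hA := (lintegral_toENNReal_logAbs_lt_top hf).ne
  have hB : Tendsto (fun k : ℕ => ∫⁻ x, min (-logAbs f x).toENNReal k ∂μ) atTop
      (𝓝 (∫⁻ x, (-logAbs f x).toENNReal ∂μ)) := by
    refine lintegral_tendsto_of_tendsto_of_monotone (fun k => ?_)
      (.of_forall fun x i j hij => min_le_min_left _ (by exact_mod_cast hij))
      (.of_forall fun x => ?_)
    · refine AEMeasurable.min ?_ aemeasurable_const
      exact measurable_ereal_toENNReal.comp_aemeasurable
        (ENNReal.measurable_log.comp_aemeasurable hf.aestronglyMeasurable.enorm).neg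
    · simpa using (tendsto_const_nhds (x := (-logAbs f x).toENNReal)).min
        ENNReal.tendsto_nat_nhds_top
  simp only [coe_integral_truncatedLog hf, erealIntegral, sub_eq_add_neg]
  -- Addition is discontinuous only at `∞ + (-∞)`, excluded because the positive part has finite
  -- integral.
  refine (EReal.continuousAt_add ?_ ?_).tendsto.comp (tendsto_const_nhds.prodMk_nhds
    ((continuous_neg.tendsto _).comp ((continuous_coe_ennreal_ereal.tendsto _).comp hB)))
  · exact .inl (EReal.coe_ennreal_eq_top_iff.not.mpr hA)
  · exact .inl (EReal.coe_ennreal_ne_bot _)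

end Integral

theorem enorm_integral_le_exp_truncatedLog (hP : IsOrder P) {f : UnitAddTorus (Fin N) → ℂ}
    (hf : f ∈ hardySpace 1 P) (k : ℕ) :
    ‖∫ x, f x ∂(haar N)‖ₑ ≤ EReal.exp ((∫ x, truncatedLog f k x ∂(haar N) : ℝ) : EReal) := by
  have hi := memLp_one_iff_integrable.mp hf.1
  rw [EReal.exp_coe, ← ofReal_norm]
  refine ENNReal.ofReal_le_ofReal ((norm_integral_le_of_integrable hP hf
    (integrable_truncatedLog hi k) (neg_le_truncatedLog f k)).trans ?_)
  -- On a probability space the pointwise bound by 1 bounds the first factor by 1.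
  refine mul_le_of_le_one_left (Real.exp_pos _).le ?_
  have := integral_mono_of_nonneg (μ := haar N) (.of_forall fun x => by positivity)
    (integrable_const (1 : ℝ)) (.of_forall (norm_mul_exp_neg_truncatedLog_le f k))
  simpa using this

end HardyTorus

theorem proposition3p3 (N : ℕ) (P : Set (Fin N → ℤ)) (hP : HardyTorus.IsOrder P)
    (f : UnitAddTorus (Fin N) → ℂ) (hf : f ∈ HardyTorus.hardySpace 1 P) :
    ∫⁻ x, (HardyTorus.logAbs f x).toENNReal ∂(HardyTorus.haar N) < ∞ ∧
      ‖∫ x, f x ∂(HardyTorus.haar N)‖ₑ ≤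
        EReal.exp (HardyTorus.erealIntegral (HardyTorus.haar N) (HardyTorus.logAbs f)) := by
  have hi := memLp_one_iff_integrable.mp hf.1
  exact ⟨HardyTorus.lintegral_toENNReal_logAbs_lt_top hi,
    ge_of_tendsto ((ENNReal.continuous_exp.tendsto _).comp
      (HardyTorus.tendsto_integral_truncatedLog hi))
      (.of_forall (HardyTorus.enorm_integral_le_exp_truncatedLog hP hf))⟩
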